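/- Let $(W,S)$ be a Coxeter system (of arbitrary, possibly infinite, rank), with length function $l=l_S$ and set of reflections $T=\{wsw^{-1}\mid w\in W,\ s\in S\}$. **Definitions.** A *protorootoid* over a group $G$ is a triple $(G,\Lambda,N)$, where $\Lambda$ is a (not necessarily unital) Boolean ring on which $G$ acts by ring automorphisms and $N\colon G\to\Lambda$ satisfies $N(gh)=N(g)+gN(h)$. It is *faithful* if $N(g)=0$ implies $g=1$, and *cocycle finite* if every $N(g)$ has finite rank in $\Lambda$. Its *weak order* is the relation $x\le y\iff N(x)\subseteq N(y)$ on $G$. It is a *rootoid* if it is faithful, every non-empty subset of $G$ has a meet in the weak order, and, whenever a subset $A\subseteq G$ has a join $m$ and $y\in G$ satisfies $N(x)\cap N(y)=0$ for all $x\in A$, also $N(m)\cap N(y)=0$. It is *principal*, with set of *simple generators* $R=\{g\in G\mid \operatorname{rank}N(g)=1\}$, if it is faithful and cocycle finite, $R$ generates $G$, and $\operatorname{rank}N(g)=l_R(g)$ for all $g\in G$. Let $G$ be a group and $S\subseteq G$ a generating set with $S=S^{-1}$ and $1\notin S$ (a *$C_0$-system*). It is *even* if there is a homomorphism $G\to\{\pm1\}$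 taking the value $-1$ at every $s\in S$. For $s\in S$ put $G_s^{>}=\{g\in G\mid l_S(s^{-1}g)>l_S(g)\}$; let $\Psi=\{gG_s^{>}\mid g\in G,\ s\in S\}$, with $G$ acting by left translation, $\Psi'=\{A\in\Psi\mid 1\in A\}$, $N(g)=\Psi'+g\Psi'$ (symmetric difference), and $\mathcal J_{(G,S)}=(G,\wp(\Psi),N)$, where $\wp(\Psi)$ is the Boolean ring of subsets of $\Psi$. The pair $(G,S)$ satisfies the *weak exchange condition* (WEC) if $|N(g)|=2l_S(g)$ for all $g\in G$; it is a *$C_2$-system* if it satisfies WEC and $\mathcal J_{(G,S)}$ is a rootoid. If $(G,S)$ is even, then $\Psi$ is stable under complementation, and $\widehat\Psi$ denotes the signed $G$-set $\Psi$ with $-A=G\setminus A$ and with $\Psi'$ as its set of positive elements; $\overline{\mathcal J}_{(G,S)}=(G,\wp(\widehat\Psi/\{\pm\}),\overline N)$ is the associated protorootoid, with $\overline N(g)=\{\{\pm A\}\mid A\in\widehat\Psi_+\cap g\widehat\Psi_-\}$. The *abstract root system* of $(W,S)$ is the signed $W$-set $\Phi=T\times\{\pm\}$ with $-(t,\epsilon)=(t,-\epsilon)$,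 positive elements $T\times\{+\}$, and the $W$-action determined by $s(t,\epsilon)=(sts,\epsilon)$ for $s\in S$, $t\in T\setminus\{s\}$, and $s(s,\epsilon)=(s,-\epsilon)$. **Proposition.** 1. $(W,S)$ is an even $C_2$-system; that is, it is an even $C_0$-system, it satisfies WEC, and $\mathcal J_{(W,S)}$ is a rootoid. 2. There is a unique map $f\colon\Phi\to\widehat\Psi$, commuting with the actions of $W$ and of $\{\pm\}$, such that $f(s,+)=G_s^{>}$ (with $G=W$) for all $s\in S$. It is an isomorphism of signed $W$-sets, that is, it is bijective, and $f(x)$ is positive if and only if $x$ is. It is given by $f(t,+)=\{w\in W\mid l(tw)>l(w)\}$ and $f(t,-)=\{w\in W\mid l(tw)<l(w)\}$ for $t\in T$. 3. $\overline{\mathcal J}_{(W,S)}$ is a rootoid and is principal, with set of simple generators $S$. -/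

import Mathlib

section SignedSets

open scoped Pointwise

universe u

/-! Groups are regarded as groupoids with one object, so that functors from the groupoid to sets
(Boolean rings) are sets (Boolean rings) on which the group acts. -/

/-- A protorootoid `(G, Λ, N)`: a Boolean ring `Λ` (not necessarily unital) on which `G` acts by
ring automorphisms, with a cocycle `N : G → Λ`.  A Boolean ring is given here as the corresponding
generalized Boolean algebra: its sum is the symmetric difference and its product is the meet. -/
structure Protorootoid (G : Type u) [Group G] where
  Λ : Type u
  [algebra : GeneralizedBooleanAlgebra Λ]
  [action : MulAction G Λ]
  smul_symmDiff : ∀ (g : G) (x y : Λ), g • symmDiff x y = symmDiff (g • x) (g • y)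
  smul_inf : ∀ (g : G) (x y : Λ), g • (x ⊓ y) = (g • x) ⊓ (g • y)
  N : G → Λ
  N_mul : ∀ g h : G, N (g * h) = symmDiff (N g) (g • N h)

attribute [instance] Protorootoid.algebra Protorootoid.action

/-- A set protorootoid `(G, Ψ, N)`: a `G`-set `Ψ` and a `G`-cocycle `N` with values in the Boolean
ring of subsets of `Ψ`. -/
structure SetProtorootoid (G : Type u) [Group G] where
  Ψ : Type u
  [action : MulAction G Ψ]
  N : G → Set Ψ
  N_mul : ∀ g h : G, N (g * h) = symmDiff (N g) (g • N h)

attribute [instance] SetProtorootoid.action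

/-- A (definitely) signed `G`-set: a set with commuting actions of `G` and of the sign group, the
latter given by the involution `neg`, and with a subset `pos` of positive elements which contains
exactly one of `x` and `neg x` for each `x`. -/
structure SignedGSet (G : Type u) [Group G] where
  carrier : Type u
  [action : MulAction G carrier]
  neg : carrier → carrier
  neg_neg : ∀ x, neg (neg x) = x
  smul_neg : ∀ (g : G) (x : carrier), g • neg x = neg (g • x)
  pos : Set carrier
  neg_mem_pos : ∀ x, neg x ∈ pos ↔ x ∉ pos

attribute [instance] SignedGSet.action

/-! ### Length functions and half-spaces of a group with a set of generators -/

/-- The length of `g` with respect to `S` (for `S` generating `G` as a monoid). -/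
noncomputable def wordLength {G : Type u} [Group G] (S : Set G) (g : G) : ℕ :=
  sInf {n | ∃ L : List G, (∀ x ∈ L, x ∈ S) ∧ L.prod = g ∧ L.length = n}

/-- `(G, S)` is a `C₀`-system. -/
structure IsC0System {G : Type u} [Group G] (S : Set G) : Prop where
  closure_eq_top : Subgroup.closure S = ⊤
  inv_mem : ∀ s ∈ S, s⁻¹ ∈ S
  one_notMem : (1 : G) ∉ S

/-- `(G, S)` is an even `C₀`-system: it has a sign character. -/
structure IsEvenC0System {G : Type u} [Group G] (S : Set G) : Prop extends IsC0System S where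
  exists_sign : ∃ ε : G →* ℤˣ, ∀ s ∈ S, ε s = -1

/-- The set `G_s^>` of those `g` with `l(s⁻¹ g) > l(g)`. -/
def posHalf {G : Type u} [Group G] (S : Set G) (s : G) : Set G :=
  {g | wordLength S g < wordLength S (s⁻¹ * g)}

/-- The set of all translates `g G_s^>`, for `g ∈ G` and `s ∈ S`. -/
def halfSpaces {G : Type u} [Group G] (S : Set G) : Set (Set G) :=
  {A | ∃ g : G, ∃ s ∈ S, A = g • posHalf S s}

theorem smul_mem_halfSpaces {G : Type u} [Group G] {S : Set G} (g : G) {A : Set G}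
    (hA : A ∈ halfSpaces S) : g • A ∈ halfSpaces S := by
  obtain ⟨h, s, hs, rfl⟩ := hA
  exact ⟨g * h, s, hs, by rw [mul_smul]⟩

/-- `G` acts on the set of half-spaces by left translation. -/
instance halfSpacesAction {G : Type u} [Group G] (S : Set G) :
    MulAction G (halfSpaces S) where
  smul g A := ⟨g • (A : Set G), smul_mem_halfSpaces g A.2⟩
  one_smul A := Subtype.ext (one_smul G (A : Set G))
  mul_smul g h A := Subtype.ext (mul_smul g h (A : Set G))

/-- The set protorootoid `J'` of `(G, S)`, with the coboundary `N(g) = Ψ' + g Ψ'`, where `Ψ'` is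
the set of half-spaces that contain `1`. -/
def setProtorootoidOf {G : Type u} [Group G] (S : Set G) : SetProtorootoid G where
  Ψ := halfSpaces S
  N g := symmDiff {A : halfSpaces S | (1 : G) ∈ (A : Set G)}
    (g • {A : halfSpaces S | (1 : G) ∈ (A : Set G)})
  N_mul g h := by
    rw [Set.smul_set_symmDiff, smul_smul, symmDiff_assoc, symmDiff_symmDiff_cancel_left]

/-- The protorootoid `(G, ℘(Ψ), N)` of a set protorootoid `(G, Ψ, N)`. -/
def SetProtorootoid.toProtorootoid {G : Type u} [Group G] (R : SetProtorootoid G) :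
    Protorootoid G where
  Λ := Set R.Ψ
  algebra := inferInstance
  action := inferInstance
  smul_symmDiff _ _ _ := Set.smul_set_symmDiff
  smul_inf _ _ _ := Set.smul_set_inter
  N := R.N
  N_mul := R.N_mul

namespace Protorootoid

variable {G : Type u} [Group G] (R : Protorootoid G)

/-- The weak (pre)order on `G`. -/
def WeakLE (x y : G) : Prop := R.N x ≤ R.N y

/-- `m` is a greatest lower bound of `A` in the weak order. -/
def IsMeet (A : Set G) (m : G) : Prop :=
  (∀ x ∈ A, R.WeakLE m x) ∧ ∀ z, (∀ x ∈ A, R.WeakLE z x) → R.WeakLE z m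

/-- `m` is a least upper bound of `A` in the weak order. -/
def IsJoin (A : Set G) (m : G) : Prop :=
  (∀ x ∈ A, R.WeakLE x m) ∧ ∀ z, (∀ x ∈ A, R.WeakLE x z) → R.WeakLE m z

/-- Faithfulness: only the identity has value `0` under the cocycle. -/
def IsFaithful : Prop := ∀ g, R.N g = ⊥ → g = 1

/-- A rootoid is a faithful protorootoid whose weak order is a complete meet semilattice (every
non-empty subset has a meet) and which has the join orthogonality property: if `y` is orthogonal
to every element of a set that has a join, then `y` is orthogonal to the join. -/
structure IsRootoid : Prop where
  faithful : R.IsFaithful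
  exists_meet : ∀ A : Set G, A.Nonempty → ∃ m, R.IsMeet A m
  join_orthogonality : ∀ (A : Set G) (m y : G), R.IsJoin A m →
    (∀ x ∈ A, R.N x ⊓ R.N y = ⊥) → R.N m ⊓ R.N y = ⊥

/-- The rank of `N(g)` in the poset `Λ`, that is, the supremum of the lengths of the chains that
end in `N(g)`. -/
noncomputable def rank (g : G) : ℕ∞ := Order.height (R.N g)

/-- All the values of the cocycle have finite rank. -/
def IsCocycleFinite : Prop := ∀ g, R.rank g ≠ ⊤

/-- The simple elements: those whose value under the cocycle has rank one. -/
def simples : Set G := {g | R.rank g = 1}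

/-- A principal protorootoid: it is faithful and cocycle finite, the simple elements generate the
group, and the length function for these generators is the rank of the cocycle. -/
structure IsPrincipal : Prop where
  faithful : R.IsFaithful
  cocycleFinite : R.IsCocycleFinite
  closure_simples : Subgroup.closure R.simples = ⊤
  rank_eq : ∀ g, R.rank g = wordLength R.simples g

end Protorootoid

/-- `(G, S)` is a `C₁`-system: the weak exchange condition (WEC) holds. -/
structure IsC1System {G : Type u} [Group G] (S : Set G) : Prop extends IsC0System S where
  cocycleFinite : (setProtorootoidOf S).toProtorootoid.IsCocycleFinite
  rank_eq : ∀ g, (setProtorootoidOf S).toProtorootoid.rank g = 2 * wordLength S g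

/-- `(G, S)` is a `C₂`-system. -/
structure IsC2System {G : Type u} [Group G] (S : Set G) : Prop extends IsC1System S where
  isRootoid : (setProtorootoidOf S).toProtorootoid.IsRootoid

namespace IsEvenC0System

variable {G : Type u} [Group G] {S : Set G}

theorem wordLength_ne (h : IsEvenC0System S) {s : G} (hs : s ∈ S) (g : G) :
    wordLength S (s⁻¹ * g) ≠ wordLength S g := by
  obtain ⟨ε, hε⟩ := h.exists_sign
  have key : ∀ g : G, ε g = (-1) ^ wordLength S g := by
    intro g
    have hne : {n | ∃ L : List G, (∀ x ∈ L, x ∈ S) ∧ L.prod = g ∧ L.length = n}.Nonempty := by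
      have hg : g ∈ (Subgroup.closure S).toSubmonoid := by
        rw [h.closure_eq_top]; trivial
      rw [Subgroup.closure_toSubmonoid] at hg
      obtain ⟨L, hL, hp⟩ := Submonoid.exists_list_of_mem_closure hg
      refine ⟨_, L, fun x hx => ?_, hp, rfl⟩
      rcases hL x hx with hx' | hx'
      · exact hx'
      · simpa using h.inv_mem _ hx'
    obtain ⟨L, hL, hp, hl⟩ := Nat.sInf_mem hne
    have : ∀ L : List G, (∀ x ∈ L, x ∈ S) → ε L.prod = (-1) ^ L.length := by
      intro L
      induction L with
      | nil => simp
      | cons a L ih =>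
        intro hL
        rw [List.prod_cons, map_mul, hε a (hL a (by simp)),
          ih (fun x hx => hL x (by simp [hx])), List.length_cons, pow_succ']
    rw [← hp, this L hL, hl, hp]
    rfl
  intro heq
  have h1 : ε (s⁻¹ * g) = ε g := by rw [key, key g, heq]
  rw [map_mul, hε _ (h.inv_mem s hs)] at h1
  have h2 : (-1 : ℤˣ) = 1 := mul_eq_right.1 h1
  exact absurd h2 (by decide)

theorem compl_mem (h : IsEvenC0System S) {A : Set G} (hA : A ∈ halfSpaces S) :
    Aᶜ ∈ halfSpaces S := by
  obtain ⟨g, s, hs, rfl⟩ := hA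
  refine ⟨g * s, s⁻¹, h.inv_mem s hs, ?_⟩
  rw [mul_smul, ← Set.smul_set_compl]
  congr 1
  ext x
  have := h.wordLength_ne hs x
  simp only [Set.mem_smul_set_iff_inv_smul_mem, posHalf, Set.mem_compl_iff, Set.mem_ofPred_eq,
    smul_eq_mul, inv_inv, mul_inv_cancel_left]
  omega

/-- The signed `G`-set of half-spaces of an even `C₀`-system: the negative of a half-space is its
complement, and the positive half-spaces are those that contain `1`. -/
def signedHalfSpaces (h : IsEvenC0System S) : SignedGSet G where
  carrier := halfSpaces S
  action := halfSpacesAction S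
  neg A := ⟨(A : Set G)ᶜ, h.compl_mem A.2⟩
  neg_neg _ := Subtype.ext (compl_compl _)
  smul_neg _ _ := Subtype.ext Set.smul_set_compl
  pos := {A | (1 : G) ∈ (A : Set G)}
  neg_mem_pos _ := Iff.rfl

end IsEvenC0System

namespace SignedGSet

variable {G : Type u} [Group G] (Φ : SignedGSet G)

/-- The orbits of the sign group. -/
def signSetoid : Setoid Φ.carrier where
  r x y := x = y ∨ x = Φ.neg y
  iseqv :=
    { refl := fun _ => Or.inl rfl
      symm := by
        rintro x y (rfl | rfl)
        · exact Or.inl rfl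
        · exact Or.inr (Φ.neg_neg _).symm
      trans := by
        rintro x y z (rfl | rfl) (rfl | rfl)
        · exact Or.inl rfl
        · exact Or.inr rfl
        · exact Or.inr rfl
        · exact Or.inl (Φ.neg_neg _) }

/-- The induced action of `G` on the set of orbits of the sign group. -/
instance quotientAction : MulAction G (Quotient Φ.signSetoid) where
  smul g := Quotient.map (fun x => g • x) (by
    rintro x y (rfl | rfl)
    · exact Or.inl rfl
    · exact Or.inr (Φ.smul_neg _ _))
  one_smul := by
    rintro ⟨x⟩
    exact congrArg (Quotient.mk Φ.signSetoid) (one_smul G x)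
  mul_smul := by
    rintro g h ⟨x⟩
    exact congrArg (Quotient.mk Φ.signSetoid) (mul_smul g h x)

/-- The set `Φ_g = Φ₊ ∩ g Φ₋`. -/
def inversions (g : G) : Set Φ.carrier := Φ.pos ∩ g • (Φ.pos)ᶜ

theorem mk_mem_iff (g : G) (x : Φ.carrier) :
    Quotient.mk Φ.signSetoid x ∈ Quotient.mk Φ.signSetoid '' Φ.inversions g ↔
      Xor (x ∈ Φ.pos) (g⁻¹ • x ∈ Φ.pos) := by
  constructor
  · rintro ⟨y, ⟨hy, hy'⟩, hxy⟩
    rw [Set.mem_smul_set_iff_inv_smul_mem, Set.mem_compl_iff] at hy'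
    rcases Quotient.exact hxy with h | h
    · subst h
      exact Or.inl ⟨hy, hy'⟩
    · subst h
      rw [Φ.smul_neg, Φ.neg_mem_pos, not_not] at hy'
      exact Or.inr ⟨hy', (Φ.neg_mem_pos _).1 hy⟩
  · rintro (⟨h1, h2⟩ | ⟨h1, h2⟩)
    · exact ⟨x, ⟨h1, by rwa [Set.mem_smul_set_iff_inv_smul_mem]⟩, rfl⟩
    · refine ⟨Φ.neg x, ⟨(Φ.neg_mem_pos x).2 h2, ?_⟩, Quotient.sound (Or.inr rfl)⟩
      rw [Set.mem_smul_set_iff_inv_smul_mem, Φ.smul_neg, Set.mem_compl_iff, Φ.neg_mem_pos,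
        not_not]
      exact h1

/-- The set protorootoid of a signed `G`-set: the `G`-set of orbits of the sign group, with
`N(g)` the set of orbits of the elements of `Φ_g`. -/
def toSetProtorootoid : SetProtorootoid G where
  Ψ := Quotient Φ.signSetoid
  action := Φ.quotientAction
  N g := Quotient.mk Φ.signSetoid '' Φ.inversions g
  N_mul g h := by
    ext q
    induction q using Quotient.inductionOn with
    | h x =>
      have hs : g⁻¹ • Quotient.mk Φ.signSetoid x = Quotient.mk Φ.signSetoid (g⁻¹ • x) := rfl
      rw [Set.mem_symmDiff, Set.mem_smul_set_iff_inv_smul_mem, hs, mk_mem_iff, mk_mem_iff,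
        mk_mem_iff, mul_inv_rev, mul_smul]
      unfold Xor
      tauto

variable {Φ} {Φ' : SignedGSet G}

/-- Maps that commute with the actions of `G` and of the sign group. -/
structure IsHom (f : Φ.carrier → Φ'.carrier) : Prop where
  map_smul : ∀ (g : G) (x : Φ.carrier), f (g • x) = g • f x
  map_neg : ∀ x : Φ.carrier, f (Φ.neg x) = Φ'.neg (f x)

/-- Isomorphisms of signed `G`-sets: bijective equivariant maps that preserve and reflect
positivity. -/
structure IsIso (f : Φ.carrier → Φ'.carrier) : Prop extends IsHom f where
  bijective : Function.Bijective f
  mem_pos_iff : ∀ x : Φ.carrier, f x ∈ Φ'.pos ↔ x ∈ Φ.pos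

end SignedGSet

theorem height_set_eq_encard {α : Type u} (A : Set α) : Order.height A = A.encard := by
  have hfin : ∀ (n : ℕ) (F : Finset α), F.card = n → Order.height (F : Set α) = n := by
    intro n
    induction n with
    | zero =>
      intro F hF
      rw [Finset.card_eq_zero] at hF
      subst hF
      simp
    | succ n ih =>
      intro F hF
      apply le_antisymm
      · refine Order.height_le_coe_iff.2 fun y hy => ?_
        obtain ⟨a, haF, hay⟩ := Set.exists_of_ssubset hy
        classical
        have hle : y ≤ ((F.erase a : Finset α) : Set α) := by
          intro z hz
          rw [Finset.coe_erase]
          exact ⟨hy.1 hz, fun h => hay (h ▸ hz)⟩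
        refine lt_of_le_of_lt (Order.height_mono hle) ?_
        rw [ih _ (by rw [Finset.card_erase_of_mem haF, hF]; rfl)]
        exact_mod_cast Nat.lt_succ_self n
      · classical
        obtain ⟨a, F', ha, rfl, hc⟩ := Finset.card_eq_succ.1 hF
        rw [Nat.cast_succ, ← ih F' hc]
        apply Order.height_add_one_le
        exact_mod_cast Finset.ssubset_insert ha
  by_cases hA : A.Finite
  · obtain ⟨F, rfl⟩ := hA.exists_finset_coe
    rw [hfin _ F rfl, Set.encard_coe_eq_coe_finsetCard]
  · rw [Set.encard_eq_top hA, ENat.eq_top_iff_forall_ge]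
    intro n
    obtain ⟨F, hF, hc⟩ := Set.Infinite.exists_subset_card_eq hA n
    rw [← hfin n F hc]
    exact Order.height_mono hF

/-- The rank of `N(g)` in the Boolean ring of subsets is the cardinality of `N(g)`. -/
theorem SetProtorootoid.rank_eq_encard {G : Type u} [Group G] (R : SetProtorootoid G) (g : G) :
    R.toProtorootoid.rank g = (R.N g).encard :=
  height_set_eq_encard (R.N g)

end SignedSets

/-! ### The abstract root system of a Coxeter system -/

namespace CoxeterSystem

universe u v

variable {B : Type v} {M : CoxeterMatrix B} {W : Type u} [Group W] (cs : CoxeterSystem M W)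

open Classical in
/-- The map `(t, ε) ↦ (s t s, ± ε)` on `T × {±}` attached to a simple reflection `s`, where `T` is
the set of reflections and the sign is `-` if and only if `t = s`. -/
noncomputable def rootStep (i : B) (x : {t : W // cs.IsReflection t} × ℤˣ) :
    {t : W // cs.IsReflection t} × ℤˣ :=
  (⟨cs.simple i * x.1 * (cs.simple i)⁻¹, x.1.2.conj _⟩,
    (if (x.1 : W) = cs.simple i then -1 else 1) * x.2)

theorem rootStep_rootStep (i : B) (x : {t : W // cs.IsReflection t} × ℤˣ) :
    cs.rootStep i (cs.rootStep i x) = x := by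
  classical
  obtain ⟨⟨t, ht⟩, e⟩ := x
  have h : cs.simple i * t * (cs.simple i)⁻¹ = cs.simple i ↔ t = cs.simple i := by
    rw [mul_inv_eq_iff_eq_mul, mul_right_inj]
  refine Prod.ext (Subtype.ext ?_) ?_
  · simp [rootStep, mul_assoc]
  · show (if cs.simple i * t * (cs.simple i)⁻¹ = cs.simple i then (-1 : ℤˣ) else 1) *
      ((if t = cs.simple i then -1 else 1) * e) = e
    by_cases ht' : t = cs.simple i
    · rw [if_pos ht', if_pos (h.2 ht')]; simp
    · rw [if_neg ht', if_neg (fun h' => ht' (h.1 h'))]; simp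

/-- The involution `rootStep` as a permutation. -/
noncomputable def rootPerm (i : B) : Equiv.Perm ({t : W // cs.IsReflection t} × ℤˣ) where
  toFun := cs.rootStep i
  invFun := cs.rootStep i
  left_inv := cs.rootStep_rootStep i
  right_inv := cs.rootStep_rootStep i

theorem rootPerm_isLiftable : M.IsLiftable cs.rootPerm := by
  classical
  intro i j
  set p : W := cs.simple i * cs.simple j with hp
  have hpinv : p⁻¹ = cs.simple j * cs.simple i := by simp [hp]
  have hr : ∀ n : ℕ, p⁻¹ * (cs.simple j * p ^ n) * p = cs.simple j * p ^ (n + 2) := by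
    intro n
    have : p⁻¹ * cs.simple j = cs.simple j * p := by rw [hpinv, hp, mul_assoc]
    calc p⁻¹ * (cs.simple j * p ^ n) * p = (p⁻¹ * cs.simple j) * p ^ n * p := by group
      _ = cs.simple j * p ^ (n + 2) := by rw [this]; group
  have hstep : ∀ x : {t : W // cs.IsReflection t} × ℤˣ,
      (((cs.rootPerm i * cs.rootPerm j) x).1 : W) = p * x.1 * p⁻¹ ∧
      ((cs.rootPerm i * cs.rootPerm j) x).2 =
        ((if (x.1 : W) = cs.simple j * p ^ 0 then -1 else 1) *
          (if (x.1 : W) = cs.simple j * p ^ 1 then -1 else 1)) * x.2 := by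
    rintro ⟨⟨t, ht⟩, e⟩
    have h1 : cs.simple j * t * (cs.simple j)⁻¹ = cs.simple i ↔ t = cs.simple j * p ^ 1 := by
      rw [mul_inv_eq_iff_eq_mul, pow_one, ← hp, ← eq_inv_mul_iff_mul_eq, cs.inv_simple]
    constructor
    · simp [rootPerm, rootStep, hp, mul_assoc]
    · simp only [rootPerm, rootStep, Equiv.Perm.coe_mul, Function.comp_apply, Equiv.coe_fn_mk, h1,
        pow_zero, mul_one]
      rw [← mul_assoc]
      congr 1
      rw [mul_comm]
  have hpow : ∀ (k : ℕ) (x : {t : W // cs.IsReflection t} × ℤˣ),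
      ((((cs.rootPerm i * cs.rootPerm j) ^ k) x).1 : W) = p ^ k * x.1 * (p ^ k)⁻¹ ∧
      (((cs.rootPerm i * cs.rootPerm j) ^ k) x).2 =
        (∏ n ∈ Finset.range (2 * k),
          (if (x.1 : W) = cs.simple j * p ^ n then (-1 : ℤˣ) else 1)) * x.2 := by
    intro k
    induction k with
    | zero => intro x; simp
    | succ k ih =>
      intro x
      obtain ⟨a1, a2⟩ := hstep x
      obtain ⟨b1, b2⟩ := ih ((cs.rootPerm i * cs.rootPerm j) x)
      rw [pow_succ, Equiv.Perm.mul_apply]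
      constructor
      · rw [b1, a1]
        group
      · have hiff : ∀ n : ℕ, p * (x.1 : W) * p⁻¹ = cs.simple j * p ^ n ↔
            (x.1 : W) = cs.simple j * p ^ (n + 2) := by
          intro n
          rw [← hr n, mul_inv_eq_iff_eq_mul, ← eq_inv_mul_iff_mul_eq, mul_assoc p⁻¹]
        rw [b2, a2, a1]
        simp only [hiff]
        rw [show 2 * (k + 1) = 2 * k + 2 by ring, Finset.prod_range_succ', Finset.prod_range_succ']
        simp only [Nat.zero_add, Nat.add_assoc, Nat.reduceAdd]
        rw [← mul_assoc]
        congr 1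
        rw [mul_assoc]
        congr 1
        rw [mul_comm]
  have hm : p ^ M i j = 1 := cs.simple_mul_simple_pow i j
  ext1 x
  obtain ⟨c1, c2⟩ := hpow (M i j) x
  refine Prod.ext (Subtype.ext ?_) ?_
  · rw [c1, hm]; simp
  · rw [c2, two_mul, Finset.prod_range_add]
    simp only [pow_add, hm, one_mul]
    rw [Int.units_mul_self, one_mul]
    rfl

/-- The action of `W` on `T × {±}`, determined by `s (t, ε) = (s t s, ± ε)` for `s` simple. -/
noncomputable def rootAction : W →* Equiv.Perm ({t : W // cs.IsReflection t} × ℤˣ) :=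
  cs.lift ⟨cs.rootPerm, cs.rootPerm_isLiftable⟩

theorem rootAction_simple (i : B) (x : {t : W // cs.IsReflection t} × ℤˣ) :
    cs.rootAction (cs.simple i) x = cs.rootStep i x := by
  rw [rootAction, lift_apply_simple]
  rfl

theorem rootAction_neg (w : W) (x : {t : W // cs.IsReflection t} × ℤˣ) :
    cs.rootAction w (x.1, -x.2) = ((cs.rootAction w x).1, -(cs.rootAction w x).2) := by
  revert x
  refine cs.simple_induction_left (p := fun w => ∀ x, cs.rootAction w (x.1, -x.2) =
    ((cs.rootAction w x).1, -(cs.rootAction w x).2)) w (fun x => ?_) (fun w i ih x => ?_)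
  · simp
  · rw [map_mul, Equiv.Perm.mul_apply, Equiv.Perm.mul_apply, ih, rootAction_simple,
      rootAction_simple]
    simp [rootStep]

/-- The abstract root system `Φ = T × {±}` of a Coxeter system as a signed `W`-set, with the set
`T × {+}` of positive elements. -/
noncomputable def abstractRootSystem : SignedGSet W where
  carrier := {t : W // cs.IsReflection t} × ℤˣ
  action := MulAction.compHom _ cs.rootAction
  neg x := (x.1, -x.2)
  neg_neg x := by simp
  smul_neg w x := cs.rootAction_neg w x
  pos := {x | x.2 = 1}
  neg_mem_pos x := by
    rcases Int.units_eq_one_or x.2 with h | h <;> simp [h]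

/-- The half-spaces `W_(t, +) = {w | l(t w) > l(w)}` and `W_(t, -) = {w | l(t w) < l(w)}`. -/
def rootHalfSpace (x : {t : W // cs.IsReflection t} × ℤˣ) : Set W :=
  {w | (x.2 = 1 ∧ cs.length w < cs.length (x.1 * w)) ∨
    (x.2 = -1 ∧ cs.length (x.1 * w) < cs.length w)}

/-- The positive root `(s, +)` of a simple reflection `s`. -/
def simpleRoot (i : B) : {t : W // cs.IsReflection t} × ℤˣ :=
  (⟨cs.simple i, cs.isReflection_simple i⟩, 1)

end CoxeterSystem

/-! ### Signs of roots, strong exchange and inversion sets -/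

namespace CoxeterSystem

variable {B : Type*} {M : CoxeterMatrix B} {W : Type*} [Group W] (cs : CoxeterSystem M W)

/-! Everything is read off from the left inversion sets Φ_w = {t | l(tw) < l(w)}. The action on T ×
{±} detects them: w⁻¹ changes the sign of (t, ε) exactly when t ∈ Φ_w
(`isLeftInversion_iff_rootAction`). Hence w ↦ Φ_w is a cocycle, |Φ_w| = l(w), and inclusion of
inversion sets is the weak order of W.

By the same criterion the half-space of a root x is {w | w⁻¹x is positive}. So translation of
half-spaces matches the action on roots, complements match negatives, and x is positive exactly when
its half-space contains 1; this gives the isomorphism with T × {±}. A half-space separates 1 from g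
if and only if its reflection lies in Φ_g. Thus N(g) is the preimage of Φ_g under a two-to-one map
onto T, and the reduced cocycle is its preimage under a bijection. The ranks are therefore 2l(g) and
l(g), and `isRootoid_of_pullback` reduces both rootoid claims to meets and join orthogonality in W.

Both of these rest on a Newman-type argument (`exists_greatest_of_local`): bounded covers ds_i, i ∈
J, have the join dv, with v the longest element of the parabolic subgroup W_J
(`exists_join_covers`). Applied to the lower bounds of a set, this gives meets. Applied to the
elements below a join that lack the descent k, it gives orthogonality to s_k. Orthogonality to a
general y follows by induction on l(y), a left descent of y being moved over to the other side. -/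

theorem coe_rootAction_fst (w : W) (x : {t : W // cs.IsReflection t} × ℤˣ) :
    ((cs.rootAction w x).1 : W) = w * x.1 * w⁻¹ := by
  refine cs.simple_induction_left (p := fun w => ∀ x, ((cs.rootAction w x).1 : W) =
    w * x.1 * w⁻¹) w (fun x => ?_) (fun w i ih x => ?_) x
  · simp
  · rw [map_mul, Equiv.Perm.mul_apply, rootAction_simple]
    simp [rootStep, ih, mul_assoc]

/-- Write t = gsg⁻¹. Then g⁻¹ carries the root to one over s, which s negates, and g carries it back
because the action commutes with signs. -/
theorem rootAction_self (t : {t : W // cs.IsReflection t}) (e : ℤˣ) :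
    cs.rootAction t (t, e) = (t, -e) := by
  obtain ⟨_, g, i, rfl⟩ := t
  set x : {t : W // cs.IsReflection t} × ℤˣ := (⟨g * cs.simple i * g⁻¹, g, i, rfl⟩, e) with hx
  have h1 : cs.rootAction (cs.simple i) (cs.rootAction g⁻¹ x) =
      ((cs.rootAction g⁻¹ x).1, -(cs.rootAction g⁻¹ x).2) := by
    have h : ((cs.rootAction g⁻¹ x).1 : W) = cs.simple i := by
      rw [coe_rootAction_fst, hx]
      group
    rw [rootAction_simple]
    generalize cs.rootAction g⁻¹ x = z at h
    refine Prod.ext (Subtype.ext ?_) ?_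
    · simp [rootStep, h]
    · simp [rootStep, h]
  change cs.rootAction (g * cs.simple i * g⁻¹) x = (x.1, -x.2)
  rw [map_mul, map_mul, Equiv.Perm.mul_apply, Equiv.Perm.mul_apply, h1, rootAction_neg,
    ← Equiv.Perm.mul_apply, ← map_mul, mul_inv_cancel, map_one, Equiv.Perm.one_apply]

/-- The first letter s_i changes the sign only of the roots over s_i. Otherwise the change happens
in the rest of the word, for the reflection s_i t s_i. -/
theorem mem_leftInvSeq_of_rootAction_snd_ne (ω : List B) (x : {t : W // cs.IsReflection t} × ℤˣ)
    (h : (cs.rootAction (cs.wordProd ω)⁻¹ x).2 ≠ x.2) : (x.1 : W) ∈ cs.leftInvSeq ω := by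
  induction ω generalizing x with
  | nil => simp at h
  | cons i ω ih =>
    rw [wordProd_cons, mul_inv_rev, inv_simple, map_mul, Equiv.Perm.mul_apply,
      rootAction_simple] at h
    rw [leftInvSeq, List.mem_cons, List.mem_map]
    by_cases hx : (x.1 : W) = cs.simple i
    · exact Or.inl hx
    · refine Or.inr ⟨_, ih (cs.rootStep i x) (by simpa [rootStep, hx] using h), ?_⟩
      simp [rootStep, mul_assoc]

theorem isLeftInversion_of_rootAction_snd_ne (w : W) (x : {t : W // cs.IsReflection t} × ℤˣ)
    (h : (cs.rootAction w⁻¹ x).2 ≠ x.2) : cs.IsLeftInversion w x.1 := by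
  obtain ⟨ω, hω, rfl⟩ := cs.exists_isReduced w
  exact cs.isLeftInversion_of_mem_leftInvSeq hω (cs.mem_leftInvSeq_of_rootAction_snd_ne ω x h)

/-- The strong exchange property, in terms of the action on the abstract root system. -/
theorem isLeftInversion_iff_rootAction (w : W) (x : {t : W // cs.IsReflection t} × ℤˣ) :
    cs.IsLeftInversion w x.1 ↔ (cs.rootAction w⁻¹ x).2 ≠ x.2 := by
  refine ⟨fun h heq => ?_, cs.isLeftInversion_of_rootAction_snd_ne w x⟩
  -- Since t negates x, if w⁻¹ keeps the sign of x then (tw)⁻¹ = w⁻¹t changes it. So t is an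
  -- inversion of tw, hence not of w.
  refine (x.1.2.isLeftInversion_mul_right_iff.1 (cs.isLeftInversion_of_rootAction_snd_ne
    (x.1 * w) x ?_)) h
  rw [mul_inv_rev, x.1.2.inv, map_mul, Equiv.Perm.mul_apply,
    show x = (x.1, x.2) from rfl, rootAction_self, rootAction_neg]
  simp only [Prod.mk.eta, heq]
  rcases Int.units_eq_one_or x.2 with e | e <;> rw [e] <;> decide

/-- The sign change under (xy)⁻¹ is that under x⁻¹ followed by that under y⁻¹. -/
theorem isLeftInversion_mul_iff (x y t : W) :
    cs.IsLeftInversion (x * y) t ↔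
      Xor (cs.IsLeftInversion x t) (cs.IsLeftInversion y (x⁻¹ * t * x)) := by
  by_cases ht : cs.IsReflection t
  · have h := cs.isLeftInversion_iff_rootAction
    have h1 := h (x * y) (⟨t, ht⟩, 1)
    have h2 := h x (⟨t, ht⟩, 1)
    have h3 := h y (cs.rootAction x⁻¹ (⟨t, ht⟩, 1))
    rw [coe_rootAction_fst] at h3
    rw [mul_inv_rev, map_mul, Equiv.Perm.mul_apply] at h1
    simp only [inv_inv] at h1 h2 h3
    rw [h1, h2, h3]
    rcases Int.units_eq_one_or (cs.rootAction x⁻¹ (⟨t, ht⟩, 1)).2 with a | a <;>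
    rcases Int.units_eq_one_or (cs.rootAction y⁻¹ (cs.rootAction x⁻¹ (⟨t, ht⟩, 1))).2 with b | b <;>
    rw [a, b] <;> decide
  · have h : ¬ cs.IsReflection (x⁻¹ * t * x) := by
      have := cs.isReflection_conj_iff x⁻¹ t
      rw [inv_inv] at this
      rwa [this]
    simp [IsLeftInversion, ht, h, Xor]

theorem mem_leftInvSeq_iff {ω : List B} (hω : cs.IsReduced ω) {t : W} :
    t ∈ cs.leftInvSeq ω ↔ cs.IsLeftInversion (cs.wordProd ω) t := by
  refine ⟨cs.isLeftInversion_of_mem_leftInvSeq hω, fun h => ?_⟩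
  exact cs.mem_leftInvSeq_of_rootAction_snd_ne ω (⟨t, h.1⟩, 1)
    ((cs.isLeftInversion_iff_rootAction _ (⟨t, h.1⟩, 1)).1 h)

/-- The exchange property. -/
theorem exists_mul_wordProd_eq_eraseIdx {ω : List B} (hω : cs.IsReduced ω) {t : W}
    (h : cs.IsLeftInversion (cs.wordProd ω) t) :
    ∃ j < ω.length, t * cs.wordProd ω = cs.wordProd (ω.eraseIdx j) := by
  obtain ⟨j, hj, rfl⟩ := List.mem_iff_getElem.1 ((cs.mem_leftInvSeq_iff hω).2 h)
  refine ⟨j, by simpa using hj, ?_⟩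
  rw [← List.getD_eq_getElem _ 1 hj, getD_leftInvSeq_mul_wordProd]

/-- The set of left inversions of an element. -/
def leftInversions (w : W) : Set W := {t | cs.IsLeftInversion w t}

theorem encard_leftInversions (w : W) : (cs.leftInversions w).encard = cs.length w := by
  classical
  obtain ⟨ω, hω, rfl⟩ := cs.exists_isReduced w
  have h : cs.leftInversions (cs.wordProd ω) = ((cs.leftInvSeq ω).toFinset : Set W) := by
    ext t
    rw [List.coe_toFinset]
    exact (cs.mem_leftInvSeq_iff hω).symm
  rw [h, Set.encard_coe_eq_coe_finsetCard, List.toFinset_card_of_nodup hω.nodup_leftInvSeq,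
    length_leftInvSeq, hω.eq]

theorem finite_leftInversions (w : W) : (cs.leftInversions w).Finite := by
  rw [← Set.encard_ne_top_iff, encard_leftInversions]
  exact ENat.natCast_ne_top _

theorem ncard_leftInversions (w : W) : (cs.leftInversions w).ncard = cs.length w := by
  rw [Set.ncard, encard_leftInversions, ENat.toNat_natCast]

theorem leftInversions_mul (x y : W) : cs.leftInversions (x * y) =
    symmDiff (cs.leftInversions x) (MulAut.conj x '' cs.leftInversions y) := by
  ext t
  rw [Set.mem_symmDiff, leftInversions, Set.mem_ofPred_eq, isLeftInversion_mul_iff]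
  have : t ∈ MulAut.conj x '' cs.leftInversions y ↔ cs.IsLeftInversion y (x⁻¹ * t * x) := by
    constructor
    · rintro ⟨u, hu, rfl⟩
      simpa [mul_assoc] using! hu
    · intro h
      exact ⟨_, h, by simp [mul_assoc]⟩
  rw [this]
  rfl

/-- By the cocycle identity Φ_y is the symmetric difference of Φ_x and a set D with |D| = l(x⁻¹y).
Inclusion forces D = Φ_y \ Φ_x; conversely, if the cardinalities add up, then Φ_y ⊆ Φ_x ∪ D is an
equality. -/
theorem leftInversions_subset_iff (x y : W) : cs.leftInversions x ⊆ cs.leftInversions y ↔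
    cs.length x + cs.length (x⁻¹ * y) = cs.length y := by
  have h := cs.leftInversions_mul x (x⁻¹ * y)
  rw [mul_inv_cancel_left] at h
  have hc : (MulAut.conj x '' cs.leftInversions (x⁻¹ * y)).ncard = cs.length (x⁻¹ * y) := by
    rw [Set.ncard_image_of_injective _ (MulAut.conj x).injective, ncard_leftInversions]
  have hf := (cs.finite_leftInversions (x⁻¹ * y)).image (MulAut.conj x)
  generalize MulAut.conj x '' cs.leftInversions (x⁻¹ * y) = D at h hc hf
  rw [← cs.ncard_leftInversions x, ← hc, ← cs.ncard_leftInversions y]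
  constructor
  · intro hs
    have : D = cs.leftInversions y \ cs.leftInversions x := by
      rw [h] at hs ⊢
      ext t
      have := @hs t
      simp only [Set.mem_symmDiff, Set.mem_sdiff] at this ⊢
      tauto
    rw [this, add_comm, Set.ncard_sdiff_add_ncard_of_subset hs (cs.finite_leftInversions y)]
  · intro hl
    have h1 : cs.leftInversions y ⊆ cs.leftInversions x ∪ D := by
      rw [h]
      exact symmDiff_le_sup
    rw [Set.eq_of_subset_of_ncard_le h1 ((Set.ncard_union_le _ _).trans hl.le)
      ((cs.finite_leftInversions x).union hf)]
    exact Set.subset_union_left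

end CoxeterSystem

/-! ### The weak order -/

namespace CoxeterSystem

variable {B : Type*} {M : CoxeterMatrix B} {W : Type*} [Group W] (cs : CoxeterSystem M W)

/-- The (right) weak order of a Coxeter group. -/
def WeakLE (x y : W) : Prop := cs.length x + cs.length (x⁻¹ * y) = cs.length y

theorem weakLE_iff_subset {x y : W} :
    cs.WeakLE x y ↔ cs.leftInversions x ⊆ cs.leftInversions y :=
  (cs.leftInversions_subset_iff x y).symm

theorem weakLE_one_left (x : W) : cs.WeakLE 1 x := by simp [WeakLE]

variable {cs}

theorem WeakLE.refl (x : W) : cs.WeakLE x x := by simp [WeakLE]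

theorem WeakLE.trans {x y z : W} (h : cs.WeakLE x y) (h' : cs.WeakLE y z) : cs.WeakLE x z :=
  cs.weakLE_iff_subset.2
    ((cs.weakLE_iff_subset.1 h).trans (cs.weakLE_iff_subset.1 h'))

theorem WeakLE.length_le {x y : W} (h : cs.WeakLE x y) : cs.length x ≤ cs.length y := by
  unfold WeakLE at h
  omega

/-- The hypotheses factor a as d · v · rest with lengths adding up, so the triangle inequalities for
dv and for a are equalities. -/
theorem WeakLE.mul_left {d a v : W} (hd : cs.WeakLE d a) (hv : cs.WeakLE v (d⁻¹ * a)) :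
    cs.WeakLE (d * v) a ∧ cs.length (d * v) = cs.length d + cs.length v := by
  unfold WeakLE at *
  have h1 := cs.length_mul_le d v
  have h2 := cs.length_mul_le (d * v) ((d * v)⁻¹ * a)
  have h3 : (d * v)⁻¹ * a = v⁻¹ * (d⁻¹ * a) := by group
  rw [mul_inv_cancel_left, h3] at h2
  rw [h3]
  omega

theorem WeakLE.inv_mul {d a v : W} (hd : cs.WeakLE d a) (hv : cs.WeakLE (d * v) a)
    (hl : cs.length (d * v) = cs.length d + cs.length v) : cs.WeakLE v (d⁻¹ * a) := by
  unfold WeakLE at *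
  have h3 : (d * v)⁻¹ * a = v⁻¹ * (d⁻¹ * a) := by group
  rw [h3] at hv
  omega

theorem weakLE_mul_iff {d v : W} :
    cs.WeakLE d (d * v) ↔ cs.length (d * v) = cs.length d + cs.length v := by
  rw [WeakLE, inv_mul_cancel_left]
  omega

theorem weakLE_simple_iff {i : B} {u : W} :
    cs.WeakLE (cs.simple i) u ↔ cs.IsLeftDescent u i := by
  rw [isLeftDescent_iff, WeakLE, length_simple, inv_simple]
  omega

theorem WeakLE.mul_of_weakLE_inv_mul {d u v : W} (hu : cs.WeakLE d (d * u))
    (hv : cs.WeakLE v u) : cs.WeakLE (d * v) (d * u) ∧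
      cs.length (d * v) = cs.length d + cs.length v :=
  hu.mul_left (by rwa [inv_mul_cancel_left])

/-! ### Standard parabolic subgroups, through reduced words -/

variable (cs)

/-- An element has a reduced word with all letters in `J`. -/
def HasReducedWordIn (J : Set B) (x : W) : Prop :=
  ∃ ω : List B, (∀ i ∈ ω, i ∈ J) ∧ cs.IsReduced ω ∧ cs.wordProd ω = x

variable {cs} {J : Set B}

/-- Either the letter can be prepended, or exchange deletes a letter; both stay within J. -/
theorem HasReducedWordIn.simple_mul {x : W} (hx : cs.HasReducedWordIn J x) {i : B} (hi : i ∈ J) :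
    cs.HasReducedWordIn J (cs.simple i * x) := by
  obtain ⟨ω, hω, hr, rfl⟩ := hx
  by_cases h : cs.IsLeftDescent (cs.wordProd ω) i
  · obtain ⟨j, hj, he⟩ := cs.exists_mul_wordProd_eq_eraseIdx hr
      ((cs.isLeftInversion_simple_iff_isLeftDescent _ i).2 h)
    refine ⟨ω.eraseIdx j, fun k hk => hω k (List.mem_of_mem_eraseIdx hk), ?_, he.symm⟩
    rw [isLeftDescent_iff, hr.eq, he] at h
    rw [IsReduced, List.length_eraseIdx_of_lt hj]
    omega
  · refine ⟨i :: ω, ?_, ?_, cs.wordProd_cons i ω⟩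
    · simpa [hi] using hω
    · rw [not_isLeftDescent_iff, hr.eq] at h
      rw [IsReduced, wordProd_cons, h, List.length_cons]

variable (cs) in
theorem hasReducedWordIn_one (J : Set B) : cs.HasReducedWordIn J (1 : W) :=
  ⟨[], by simp, by simp [IsReduced], by simp⟩

variable (cs) in
theorem hasReducedWordIn_wordProd (ω : List B) (h : ∀ i ∈ ω, i ∈ J) :
    cs.HasReducedWordIn J (cs.wordProd ω) := by
  induction ω with
  | nil => simpa using cs.hasReducedWordIn_one J
  | cons i ω ih =>
    rw [wordProd_cons]
    exact (ih fun k hk => h k (by simp [hk])).simple_mul (h i (by simp))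

theorem HasReducedWordIn.isLeftInversion {v t : W} (hv : cs.HasReducedWordIn J v)
    (ht : cs.IsLeftInversion v t) : cs.HasReducedWordIn J t := by
  obtain ⟨ω, hω, hr, rfl⟩ := hv
  obtain ⟨j, -, he⟩ := cs.exists_mul_wordProd_eq_eraseIdx hr ht
  have : t = cs.wordProd (ω.eraseIdx j ++ ω.reverse) := by
    rw [wordProd_append, ← he, wordProd_reverse, mul_inv_cancel_right]
  rw [this]
  refine cs.hasReducedWordIn_wordProd _ fun i hi => ?_
  rcases List.mem_append.1 hi with h | h
  · exact hω i (List.mem_of_mem_eraseIdx h)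
  · exact hω i (List.mem_reverse.1 h)

/-- An element with a reduced word consisting of left descents of `u` is below `u`. -/
theorem HasReducedWordIn.weakLE {x u : W} (hx : cs.HasReducedWordIn J x)
    (hu : ∀ i ∈ J, cs.IsLeftDescent u i) : cs.WeakLE x u := by
  obtain ⟨ω, hω, hr, rfl⟩ := hx
  induction ω with
  | nil => simpa using cs.weakLE_one_left u
  | cons i ω ih =>
    have hr' : cs.IsReduced ω := by simpa using hr.drop 1
    have hle := ih (fun k hk => hω k (by simp [hk])) hr'
    have hi := hu i (hω i (by simp))
    have hl : cs.length (cs.simple i * cs.wordProd ω) = cs.length (cs.wordProd ω) + 1 := by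
      rw [← wordProd_cons, hr.eq, hr'.eq, List.length_cons]
    rw [wordProd_cons]
    generalize cs.wordProd ω = x at *
    -- Here s_i is an inversion of u but not of x, so x⁻¹s_i x is an inversion of x⁻¹u. Thus (s_i
    -- x)⁻¹u is shorter than x⁻¹u, which is what s_i x ≤ u requires.
    have h := cs.isLeftInversion_mul_iff x (x⁻¹ * u) (cs.simple i)
    rw [mul_inv_cancel_left, isLeftInversion_simple_iff_isLeftDescent,
      isLeftInversion_simple_iff_isLeftDescent] at h
    have hx : ¬ cs.IsLeftDescent x i := cs.not_isLeftDescent_iff.2 hl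
    have h2 : cs.IsLeftInversion (x⁻¹ * u) (x⁻¹ * cs.simple i * x) := by
      rcases h.1 hi with h | h
      · exact absurd h.1 hx
      · exact h.1
    have h3 := h2.2
    have h4 : x⁻¹ * cs.simple i * x * (x⁻¹ * u) = (cs.simple i * x)⁻¹ * u := by
      rw [mul_inv_rev, inv_simple]
      group
    rw [h4] at h3
    have h5 := cs.length_mul_le (cs.simple i * x) ((cs.simple i * x)⁻¹ * u)
    rw [mul_inv_cancel_left] at h5
    unfold WeakLE at *
    omega

/-! ### Joins of covers, and meets -/

theorem exists_simple_mul_weakLE {d x : W} (h : cs.WeakLE d x) (hne : d ≠ x) :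
    ∃ i, cs.length (d * cs.simple i) = cs.length d + 1 ∧ cs.WeakLE (d * cs.simple i) x := by
  have h1 : d⁻¹ * x ≠ 1 := fun h => hne (inv_mul_eq_one.1 h)
  obtain ⟨i, hi⟩ := cs.exists_leftDescent_of_ne_one h1
  have := h.mul_left (weakLE_simple_iff.2 hi)
  rw [length_simple] at this
  exact ⟨i, this.2, this.1⟩

/-- The join of the covers `d s_i`, for `i ∈ J`, of an element `d`. -/
theorem exists_join_covers {d a : W} (hd : cs.WeakLE d a)
    (hJ : ∀ i ∈ J, cs.length (d * cs.simple i) = cs.length d + 1)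
    (ha : ∀ i ∈ J, cs.WeakLE (d * cs.simple i) a) :
    ∃ v, cs.HasReducedWordIn J v ∧ (∀ i ∈ J, cs.IsLeftDescent v i) ∧
      (∀ i ∈ J, cs.WeakLE (d * cs.simple i) (d * v)) ∧
      cs.length (d * v) = cs.length d + cs.length v ∧
      ∀ b, cs.WeakLE d b → (∀ i ∈ J, cs.WeakLE (d * cs.simple i) b) → cs.WeakLE (d * v) b := by
  -- After division by d the covers become left descents of d⁻¹b, so all of W_J lies below d⁻¹b. For
  -- b = a this bounds the lengths in W_J, and a longest element v exists.
  have key : ∀ b, cs.WeakLE d b → (∀ i ∈ J, cs.WeakLE (d * cs.simple i) b) →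
      ∀ v, cs.HasReducedWordIn J v → cs.WeakLE v (d⁻¹ * b) := by
    intro b hb hi v hv
    exact hv.weakLE fun i hiJ => weakLE_simple_iff.1
      (hb.inv_mul (hi i hiJ) (by rw [hJ i hiJ, length_simple]))
  have hbdd : ∀ v, cs.HasReducedWordIn J v → cs.length v ≤ cs.length (d⁻¹ * a) :=
    fun v hv => (key a hd ha v hv).length_le
  obtain ⟨v, hv, hmax⟩ : ∃ v, cs.HasReducedWordIn J v ∧
      ∀ v', cs.HasReducedWordIn J v' → cs.length v' ≤ cs.length v := by
    classical
    let P : ℕ → Prop := fun n => ∃ v, cs.HasReducedWordIn J v ∧ cs.length v = n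
    have h0 : P 0 := ⟨1, cs.hasReducedWordIn_one J, cs.length_one⟩
    obtain ⟨v, hv, hl⟩ := Nat.findGreatest_spec (P := P) (Nat.zero_le (cs.length (d⁻¹ * a))) h0
    exact ⟨v, hv, fun v' hv' => hl ▸ Nat.le_findGreatest (hbdd v' hv') ⟨v', hv', rfl⟩⟩
  have hdesc : ∀ i ∈ J, cs.IsLeftDescent v i := by
    intro i hi
    by_contra h
    rw [not_isLeftDescent_iff] at h
    have := hmax _ (hv.simple_mul hi)
    omega
  have hl := (hd.mul_left (key a hd ha v hv)).2
  exact ⟨v, hv, hdesc, fun i hi => (WeakLE.mul_of_weakLE_inv_mul (weakLE_mul_iff.2 hl)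
    (weakLE_simple_iff.2 (hdesc i hi))).1, hl, fun b hb hi => (hb.mul_left (key b hb hi v hv)).1⟩

/-- A simple reflection that is an inversion of the join of the covers `d s_i` is an inversion of
`d` or of one of these covers. -/
theorem not_isLeftDescent_mul {d v : W} {k : B} (hv : cs.HasReducedWordIn J v)
    (hdesc : ∀ i ∈ J, cs.IsLeftDescent v i)
    (hl : cs.length (d * v) = cs.length d + cs.length v)
    (hk : ¬ cs.IsLeftDescent d k) (hJ : ∀ i ∈ J, ¬ cs.IsLeftDescent (d * cs.simple i) k) :
    ¬ cs.IsLeftDescent (d * v) k := by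
  intro h
  have h1 := cs.isLeftInversion_mul_iff d v (cs.simple k)
  rw [isLeftInversion_simple_iff_isLeftDescent, isLeftInversion_simple_iff_isLeftDescent] at h1
  have h2 : cs.IsLeftInversion v (d⁻¹ * cs.simple k * d) := by
    rcases h1.1 h with h | h
    · exact absurd h.1 hk
    · exact h.1
  -- This t is an inversion of v, so it lies in W_J and below v, and l(dt) = l(d) + l(t). But dt =
  -- s_k d has length l(d) + 1, so t is some s_i with i ∈ J, and ds_i = s_k d has the descent k.
  set t := d⁻¹ * cs.simple k * d with ht
  have hdt : d * t = cs.simple k * d := by rw [ht]; group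
  have hlt : cs.length (d * t) = cs.length d + cs.length t :=
    (WeakLE.mul_of_weakLE_inv_mul (weakLE_mul_iff.2 hl)
      ((hv.isLeftInversion h2).weakLE hdesc)).2
  rw [not_isLeftDescent_iff] at hk
  have ht1 : cs.length t = 1 := by
    rw [hdt] at hlt
    omega
  obtain ⟨ω, hω, hr, hωt⟩ := hv.isLeftInversion h2
  have hlen : ω.length = 1 := by rw [← hr.eq, hωt, ht1]
  obtain ⟨i, rfl⟩ := List.length_eq_one_iff.1 hlen
  rw [wordProd_singleton] at hωt
  refine hJ i (hω i (by simp)) ?_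
  rw [IsLeftDescent, hωt, hdt, simple_mul_simple_cancel_left]
  omega

/-- A version of Newman's lemma for the weak order: a locally directed set of elements of bounded
length, containing `1`, has a greatest element. -/
theorem exists_greatest_of_local {P : Set W} {n : ℕ} (h1 : (1 : W) ∈ P)
    (hdown : ∀ x y, cs.WeakLE x y → y ∈ P → x ∈ P) (hn : ∀ x ∈ P, cs.length x ≤ n)
    (hloc : ∀ d ∈ P, ∀ i j, cs.length (d * cs.simple i) = cs.length d + 1 →
      cs.length (d * cs.simple j) = cs.length d + 1 → d * cs.simple i ∈ P →
      d * cs.simple j ∈ P →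
      ∃ z ∈ P, cs.WeakLE (d * cs.simple i) z ∧ cs.WeakLE (d * cs.simple j) z) :
    ∃ g ∈ P, ∀ x ∈ P, cs.WeakLE x g := by
  -- Induction on n - l(d), for the part of P above d.
  suffices H : ∀ (k : ℕ) (d : W), d ∈ P → n ≤ cs.length d + k →
      ∃ g ∈ P, cs.WeakLE d g ∧ ∀ x ∈ P, cs.WeakLE d x → cs.WeakLE x g by
    obtain ⟨g, hg, -, h⟩ := H n 1 h1 (by omega)
    exact ⟨g, hg, fun x hx => h x hx (cs.weakLE_one_left x)⟩
  have hcover : ∀ (d : W) (i : B), cs.length (d * cs.simple i) = cs.length d + 1 →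
      cs.WeakLE d (d * cs.simple i) := by
    intro d i hi
    rw [weakLE_mul_iff, hi, length_simple]
  intro k
  induction k with
  | zero =>
    intro d hd hk
    refine ⟨d, hd, WeakLE.refl d, fun x hx hdx => ?_⟩
    by_cases hne : d = x
    · exact hne ▸ WeakLE.refl d
    · obtain ⟨i, hi, hix⟩ := exists_simple_mul_weakLE hdx hne
      have := hn _ (hdown _ _ hix hx)
      omega
  | succ k ih =>
    intro d hd hk
    by_cases hex : ∃ i, cs.length (d * cs.simple i) = cs.length d + 1 ∧ d * cs.simple i ∈ P
    · obtain ⟨i, hi, hiP⟩ := hex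
      obtain ⟨g, hg, hig, hgmax⟩ := ih _ hiP (by omega)
      refine ⟨g, hg, (hcover d i hi).trans hig, fun x hx hdx => ?_⟩
      by_cases hne : d = x
      · exact hne ▸ (hcover d i hi).trans hig
      · obtain ⟨j, hj, hjx⟩ := exists_simple_mul_weakLE hdx hne
        have hjP := hdown _ _ hjx hx
        obtain ⟨g', hg', hjg', hgmax'⟩ := ih _ hjP (by omega)
        obtain ⟨z, hz, hiz, hjz⟩ := hloc d hd i j hi hj hiP hjP
        -- The common bound z of the two covers lies below g', so g' is above ds_i and hence below
        -- g; thus x ≤ g' ≤ g.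
        exact (hgmax' x hx hjx).trans (hgmax g' hg' (hiz.trans (hgmax' z hz hjz)))
    · refine ⟨d, hd, WeakLE.refl d, fun x hx hdx => ?_⟩
      by_cases hne : d = x
      · exact hne ▸ WeakLE.refl d
      · obtain ⟨i, hi, hix⟩ := exists_simple_mul_weakLE hdx hne
        exact absurd ⟨i, hi, hdown _ _ hix hx⟩ hex

/-- The meet is the greatest lower bound produced by the local criterion: the join of two covers
that are lower bounds of A is again a lower bound. -/
theorem exists_weakLE_meet {A : Set W} (hA : A.Nonempty) :
    ∃ m, (∀ x ∈ A, cs.WeakLE m x) ∧ ∀ z, (∀ x ∈ A, cs.WeakLE z x) → cs.WeakLE z m := by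
  obtain ⟨a, ha⟩ := hA
  refine exists_greatest_of_local (cs := cs) (P := {z | ∀ x ∈ A, cs.WeakLE z x})
    (n := cs.length a) (fun x _ => cs.weakLE_one_left x)
    (fun x y hxy hy b hb => hxy.trans (hy b hb)) (fun x hx => (hx a ha).length_le) ?_
  intro d hd i j hi hj hiP hjP
  obtain ⟨v, -, -, hle, -, hub⟩ := exists_join_covers (cs := cs) (J := {i, j}) (hd a ha)
    (by rintro _ (rfl | rfl) <;> assumption)
    (by rintro _ (rfl | rfl) <;> [exact hiP a ha; exact hjP a ha])
  refine ⟨d * v, fun b hb => hub b (hd b hb) ?_, hle i (by simp), hle j (by simp)⟩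
  rintro _ (rfl | rfl) <;> [exact hiP b hb; exact hjP b hb]

/-- A simple reflection that is not a left descent of any element of `A` is not a left descent of
the join of `A`. -/
theorem not_isLeftDescent_join {A : Set W} {m : W} {k : B} (hm : ∀ x ∈ A, cs.WeakLE x m)
    (hmin : ∀ z, (∀ x ∈ A, cs.WeakLE x z) → cs.WeakLE m z)
    (hA : ∀ x ∈ A, ¬ cs.IsLeftDescent x k) : ¬ cs.IsLeftDescent m k := by
  have hdown : ∀ x y, cs.WeakLE x y → cs.IsLeftDescent x k → cs.IsLeftDescent y k := by
    intro x y h hx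
    exact weakLE_simple_iff.1 ((weakLE_simple_iff.2 hx).trans h)
  obtain ⟨g, hg, hgmax⟩ := exists_greatest_of_local (cs := cs)
    (P := {z | cs.WeakLE z m ∧ ¬ cs.IsLeftDescent z k}) (n := cs.length m)
    ⟨cs.weakLE_one_left m, cs.not_isLeftDescent_one k⟩
    (fun x y hxy hy => ⟨hxy.trans hy.1, fun h => hy.2 (hdown _ _ hxy h)⟩)
    (fun x hx => hx.1.length_le) (by
      intro d hd i j hi hj hiP hjP
      obtain ⟨v, hv, hdesc, hle, hl, hub⟩ := exists_join_covers (cs := cs) (J := {i, j}) hd.1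
        (by rintro _ (rfl | rfl) <;> assumption)
        (by rintro _ (rfl | rfl) <;> [exact hiP.1; exact hjP.1])
      refine ⟨d * v, ⟨hub m hd.1 ?_, not_isLeftDescent_mul hv hdesc hl hd.2 ?_⟩,
        hle i (by simp), hle j (by simp)⟩
      · rintro _ (rfl | rfl) <;> [exact hiP.1; exact hjP.1]
      · rintro _ (rfl | rfl) <;> [exact hiP.2; exact hjP.2])
  -- The greatest element g bounds A, so m ≤ g, and a descent k of m would pass to g.
  exact fun h => hg.2 (hdown _ _ (hmin g fun x hx => hgmax x ⟨hm x hx, hA x hx⟩) h)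

end CoxeterSystem

/-! ### Join orthogonality -/

namespace CoxeterSystem

open scoped Pointwise

universe u v

variable {B : Type v} {M : CoxeterMatrix B} {W : Type u} [Group W] (cs : CoxeterSystem M W)

theorem isLeftInversion_simple_left_iff (i : B) (t : W) :
    cs.IsLeftInversion (cs.simple i) t ↔ t = cs.simple i := by
  have h : cs.IsReduced [i] := by simp [IsReduced]
  simpa using (cs.mem_leftInvSeq_iff h (t := t)).symm

variable {cs}

/-- When s ∉ Φ_z, the set Φ_{sz} is the disjoint union of {s} and sΦ_z s. Conjugation by s thus
exchanges the two conditions, and s itself is harmless, being in neither Φ_x nor Φ_y. -/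
theorem disjoint_leftInversions_simple_mul {x y : W} {i : B} (hx : ¬ cs.IsLeftDescent x i)
    (hy : ¬ cs.IsLeftDescent y i) :
    Disjoint (cs.leftInversions x) (cs.leftInversions (cs.simple i * y)) ↔
      Disjoint (cs.leftInversions (cs.simple i * x)) (cs.leftInversions y) := by
  rw [← isLeftInversion_simple_iff_isLeftDescent] at hx hy
  have hm : ∀ z t, cs.IsLeftInversion (cs.simple i * z) t ↔
      Xor (t = cs.simple i) (cs.IsLeftInversion z (cs.simple i * t * cs.simple i)) := by
    intro z t
    rw [isLeftInversion_mul_iff, isLeftInversion_simple_left_iff, inv_simple]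
  have hc : ∀ t, cs.simple i * (cs.simple i * t * cs.simple i) * cs.simple i = t := by
    intro t
    simp [mul_assoc]
  rw [Set.disjoint_left, Set.disjoint_left]
  simp only [leftInversions, Set.mem_ofPred_eq, hm]
  constructor
  · intro h t ht hty
    have hne : t ≠ cs.simple i := by
      rintro rfl
      exact hy hty
    have hx' : cs.IsLeftInversion x (cs.simple i * t * cs.simple i) := by
      rcases ht with ht | ht
      · exact absurd ht.1 hne
      · exact ht.1
    refine h hx' (Or.inr ⟨by rwa [hc], fun he => hx ?_⟩)
    rwa [he] at hx'
  · intro h t ht hty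
    have hne : t ≠ cs.simple i := by
      rintro rfl
      exact hx ht
    have hy' : cs.IsLeftInversion y (cs.simple i * t * cs.simple i) := by
      rcases hty with hty | hty
      · exact absurd hty.1 hne
      · exact hty.1
    refine h (Or.inr ⟨by rwa [hc], fun he => hy ?_⟩) hy'
    rwa [he] at hy'

theorem weakLE_simple_mul_iff {x z : W} {i : B} (hx : ¬ cs.IsLeftDescent x i)
    (hz : ¬ cs.IsLeftDescent z i) :
    cs.WeakLE (cs.simple i * x) (cs.simple i * z) ↔ cs.WeakLE x z := by
  rw [not_isLeftDescent_iff] at hx hz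
  have : (cs.simple i * x)⁻¹ * (cs.simple i * z) = x⁻¹ * z := by group
  rw [WeakLE, WeakLE, this]
  omega

/-- The join orthogonality property of Coxeter groups. -/
theorem disjoint_leftInversions_join {A : Set W} {m y : W} (hm : ∀ x ∈ A, cs.WeakLE x m)
    (hmin : ∀ z, (∀ x ∈ A, cs.WeakLE x z) → cs.WeakLE m z)
    (hA : ∀ x ∈ A, Disjoint (cs.leftInversions x) (cs.leftInversions y)) :
    Disjoint (cs.leftInversions m) (cs.leftInversions y) := by
  induction hn : cs.length y generalizing y A m with
  | zero =>
    have := cs.encard_leftInversions y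
    rw [hn, Nat.cast_zero, Set.encard_eq_zero] at this
    rw [this]
    exact disjoint_bot_right
  | succ n ih =>
    -- The empty set is treated apart because an element of A is needed to see that every upper
    -- bound of s_i A has the descent i.
    rcases A.eq_empty_or_nonempty with rfl | ⟨a, ha⟩
    · have h1 := (hmin 1 (by simp)).length_le
      have := cs.encard_leftInversions m
      rw [length_one, Nat.le_zero] at h1
      rw [h1, Nat.cast_zero, Set.encard_eq_zero] at this
      rw [this]
      exact disjoint_bot_left
    obtain ⟨i, hi⟩ := cs.exists_leftDescent_of_ne_one (w := y) (by
      rintro rfl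
      simp at hn)
    have hxi : ∀ x ∈ A, ¬ cs.IsLeftDescent x i := fun x hx h =>
      Set.disjoint_left.1 (hA x hx) ((cs.isLeftInversion_simple_iff_isLeftDescent x i).2 h)
        ((cs.isLeftInversion_simple_iff_isLeftDescent y i).2 hi)
    have hmi := not_isLeftDescent_join hm hmin hxi
    obtain ⟨z, rfl⟩ : ∃ z, y = cs.simple i * z := ⟨cs.simple i * y, by simp⟩
    have hz : ¬ cs.IsLeftDescent z i := by
      rw [isLeftDescent_iff, simple_mul_simple_cancel_left] at hi
      rw [not_isLeftDescent_iff]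
      exact hi.symm
    rw [disjoint_leftInversions_simple_mul hmi hz]
    -- No element of A, nor m, has the descent i, so left multiplication by s_i preserves these
    -- order relations and s_i m is the join of s_i A. The induction applies to z, which is shorter
    -- than y.
    refine ih (A := (cs.simple i * ·) '' A) ?_ ?_ ?_ ?_
    · rintro _ ⟨x, hx, rfl⟩
      exact (weakLE_simple_mul_iff (hxi x hx) hmi).2 (hm x hx)
    · intro b hb
      have hsi : cs.IsLeftDescent (cs.simple i * a) i := by
        have := hxi a ha
        rw [not_isLeftDescent_iff] at this
        rw [isLeftDescent_iff, simple_mul_simple_cancel_left, this]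
      have hbi := weakLE_simple_iff.1 ((weakLE_simple_iff.2 hsi).trans (hb _ ⟨a, ha, rfl⟩))
      obtain ⟨c, rfl⟩ : ∃ c, b = cs.simple i * c := ⟨cs.simple i * b, by simp⟩
      have hc : ¬ cs.IsLeftDescent c i := by
        rw [isLeftDescent_iff, simple_mul_simple_cancel_left] at hbi
        rw [not_isLeftDescent_iff]
        exact hbi.symm
      exact (weakLE_simple_mul_iff hmi hc).2
        (hmin c fun x hx => (weakLE_simple_mul_iff (hxi x hx) hc).1 (hb _ ⟨x, hx, rfl⟩))
    · rintro _ ⟨x, hx, rfl⟩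
      exact (disjoint_leftInversions_simple_mul (hxi x hx) hz).1 (hA x hx)
    · rw [isLeftDescent_iff, simple_mul_simple_cancel_left] at hi
      omega

/-! ### Transfer to rootoids, and word length -/

variable (cs)

theorem leftInversions_eq_empty_iff {w : W} : cs.leftInversions w = ∅ ↔ w = 1 := by
  rw [← Set.encard_eq_zero, encard_leftInversions, Nat.cast_eq_zero, length_eq_zero_iff]

/-- A set protorootoid whose cocycle is the pullback of the left inversion sets along a surjection
onto the set of reflections gives a rootoid. -/
theorem isRootoid_of_pullback (R : SetProtorootoid W) (q : R.Ψ → {t : W // cs.IsReflection t})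
    (hq : Function.Surjective q) (hN : ∀ g A, A ∈ R.N g ↔ (q A : W) ∈ cs.leftInversions g) :
    R.toProtorootoid.IsRootoid := by
  have hle : ∀ x y, R.toProtorootoid.WeakLE x y ↔ cs.WeakLE x y := by
    intro x y
    rw [weakLE_iff_subset]
    change R.N x ⊆ R.N y ↔ _
    constructor
    · intro h t ht
      obtain ⟨A, hA⟩ := hq ⟨t, ht.1⟩
      have hA' : (q A : W) = t := congrArg Subtype.val hA
      have := h ((hN x A).2 (by rwa [hA']))
      rwa [hN, hA'] at this
    · intro h A hA
      exact (hN y A).2 (h ((hN x A).1 hA))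
  have horth : ∀ x y, R.toProtorootoid.N x ⊓ R.toProtorootoid.N y = ⊥ ↔
      Disjoint (cs.leftInversions x) (cs.leftInversions y) := by
    intro x y
    rw [← disjoint_iff]
    change Disjoint (R.N x) (R.N y) ↔ _
    rw [Set.disjoint_left, Set.disjoint_left]
    constructor
    · intro h t ht
      obtain ⟨A, hA⟩ := hq ⟨t, ht.1⟩
      have hA' : (q A : W) = t := congrArg Subtype.val hA
      have := h ((hN x A).2 (by rwa [hA']))
      rwa [hN, hA'] at this
    · intro h A hA hA'
      exact h ((hN x A).1 hA) ((hN y A).1 hA')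
  refine ⟨fun g hg => ?_, fun A hA => ?_, fun A m y hm hA => ?_⟩
  · have h := (horth g g).1 (by rw [inf_idem, hg])
    rwa [disjoint_self, Set.bot_eq_empty, leftInversions_eq_empty_iff] at h
  · obtain ⟨m, h1, h2⟩ := exists_weakLE_meet (cs := cs) hA
    exact ⟨m, fun x hx => (hle _ _).2 (h1 x hx),
      fun z hz => (hle _ _).2 (h2 z fun x hx => (hle _ _).1 (hz x hx))⟩
  · exact (horth m y).2 (disjoint_leftInversions_join (fun x hx => (hle _ _).1 (hm.1 x hx))
      (fun z hz => (hle _ _).1 (hm.2 z fun x hx => (hle _ _).2 (hz x hx)))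
      fun x hx => (horth x y).1 (hA x hx))

theorem wordLength_range_simple (w : W) : wordLength (Set.range cs.simple) w = cs.length w := by
  have key : ∀ L : List W, (∀ x ∈ L, x ∈ Set.range cs.simple) →
      ∃ ω : List B, ω.map cs.simple = L := fun L hL =>
    (Set.range_list_map cs.simple).ge hL
  apply le_antisymm
  · obtain ⟨ω, hω, rfl⟩ := cs.exists_isReduced w
    rw [hω.eq]
    refine Nat.sInf_le ⟨ω.map cs.simple, ?_, rfl, by simp⟩
    intro x hx
    obtain ⟨i, -, rfl⟩ := List.mem_map.1 hx
    exact ⟨i, rfl⟩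
  · refine le_csInf ?_ ?_
    · obtain ⟨ω, hω, rfl⟩ := cs.exists_isReduced w
      refine ⟨_, ω.map cs.simple, ?_, rfl, rfl⟩
      intro x hx
      obtain ⟨i, -, rfl⟩ := List.mem_map.1 hx
      exact ⟨i, rfl⟩
    · rintro n ⟨L, hL, rfl, rfl⟩
      obtain ⟨ω, rfl⟩ := key L hL
      rw [List.length_map]
      exact cs.length_wordProd_le ω

theorem isEvenC0System : IsEvenC0System (Set.range cs.simple) where
  closure_eq_top := cs.subgroup_closure_range_simple
  inv_mem := by
    rintro _ ⟨i, rfl⟩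
    exact ⟨i, (cs.inv_simple i).symm⟩
  one_notMem := by
    rintro ⟨i, hi⟩
    have := cs.length_simple i
    rw [hi, length_one] at this
    exact zero_ne_one this
  exists_sign := by
    refine ⟨cs.lift ⟨fun _ => -1, fun i j => by simp⟩, ?_⟩
    rintro _ ⟨i, rfl⟩
    exact cs.lift_apply_simple _ i

/-! ### Half-spaces and roots -/

/-- Strong exchange turns the length condition into positivity of w⁻¹x, a form in which equivariance
and complementation are formal. -/
theorem mem_rootHalfSpace_iff (x : {t : W // cs.IsReflection t} × ℤˣ) (w : W) :
    w ∈ cs.rootHalfSpace x ↔ (cs.rootAction w⁻¹ x).2 = 1 := by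
  have h := cs.isLeftInversion_iff_rootAction w x
  have hne := x.1.2.length_mul_right_ne w
  have h' : cs.length (x.1 * w) < cs.length w ↔ (cs.rootAction w⁻¹ x).2 ≠ x.2 := by
    rw [← h]
    exact ⟨fun h => ⟨x.1.2, h⟩, fun h => h.2⟩
  have h'' : cs.length w < cs.length (x.1 * w) ↔ ¬ cs.length (x.1 * w) < cs.length w := by omega
  rw [rootHalfSpace, Set.mem_ofPred_eq, h'', h']
  generalize cs.rootAction w⁻¹ x = y
  rcases Int.units_eq_one_or x.2 with e | e <;> rcases Int.units_eq_one_or y.2 with e' | e' <;>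
    rw [e, e'] <;> decide

theorem smul_rootHalfSpace (g : W) (x : {t : W // cs.IsReflection t} × ℤˣ) :
    g • cs.rootHalfSpace x = cs.rootHalfSpace (cs.rootAction g x) := by
  ext w
  rw [Set.mem_smul_set_iff_inv_smul_mem, mem_rootHalfSpace_iff, mem_rootHalfSpace_iff,
    smul_eq_mul, mul_inv_rev, inv_inv, map_mul, Equiv.Perm.mul_apply]

theorem rootHalfSpace_neg (x : {t : W // cs.IsReflection t} × ℤˣ) :
    cs.rootHalfSpace (x.1, -x.2) = (cs.rootHalfSpace x)ᶜ := by
  ext w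
  rw [Set.mem_compl_iff, mem_rootHalfSpace_iff, mem_rootHalfSpace_iff, rootAction_neg]
  generalize cs.rootAction w⁻¹ x = y
  change -y.2 = 1 ↔ ¬ y.2 = 1
  rcases Int.units_eq_one_or y.2 with e | e <;> rw [e] <;> decide

theorem rootHalfSpace_simpleRoot (i : B) :
    cs.rootHalfSpace (cs.simpleRoot i) = posHalf (Set.range cs.simple) (cs.simple i) := by
  ext w
  simp only [rootHalfSpace, simpleRoot, posHalf, Set.mem_ofPred_eq, wordLength_range_simple,
    inv_simple, true_and, or_iff_left_iff_imp, and_imp]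
  intro h
  exact absurd h (by decide)

/-- Conjugacy gives the reflection; if the sign is wrong, replace g by gs, since s negates (s, +).
-/
theorem exists_rootAction_simpleRoot (x : {t : W // cs.IsReflection t} × ℤˣ) :
    ∃ g i, cs.rootAction g (cs.simpleRoot i) = x := by
  obtain ⟨⟨_, g, i, rfl⟩, e⟩ := x
  have h1 : ((cs.rootAction g (cs.simpleRoot i)).1 : W) = g * cs.simple i * g⁻¹ := by
    rw [coe_rootAction_fst]
    rfl
  by_cases he : (cs.rootAction g (cs.simpleRoot i)).2 = e
  · exact ⟨g, i, Prod.ext (Subtype.ext h1) he⟩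
  · have h2 : cs.rootAction (g * cs.simple i) (cs.simpleRoot i) =
        ((cs.rootAction g (cs.simpleRoot i)).1, -(cs.rootAction g (cs.simpleRoot i)).2) := by
      rw [map_mul, Equiv.Perm.mul_apply, ← rootAction_neg]
      congr 1
      exact cs.rootAction_self ⟨cs.simple i, cs.isReflection_simple i⟩ 1
    refine ⟨g * cs.simple i, i, ?_⟩
    rw [h2]
    refine Prod.ext (Subtype.ext h1) ?_
    exact (Int.units_ne_iff_eq_neg.1 (Ne.symm he)).symm

theorem rootHalfSpace_mem_halfSpaces (x : {t : W // cs.IsReflection t} × ℤˣ) :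
    cs.rootHalfSpace x ∈ halfSpaces (Set.range cs.simple) := by
  obtain ⟨g, i, rfl⟩ := cs.exists_rootAction_simpleRoot x
  exact ⟨g, _, ⟨i, rfl⟩, by rw [← smul_rootHalfSpace, rootHalfSpace_simpleRoot]⟩

theorem one_mem_rootHalfSpace_iff (x : {t : W // cs.IsReflection t} × ℤˣ) :
    1 ∈ cs.rootHalfSpace x ↔ x.2 = 1 := by
  rw [mem_rootHalfSpace_iff, inv_one, map_one, Equiv.Perm.one_apply]

/-- Membership of 1 gives the sign. By equivariance one root may be taken to be (s, +); its
half-space contains 1 but not s, and (s, +) is the only positive root that s makes negative. -/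
theorem rootHalfSpace_injective : Function.Injective cs.rootHalfSpace := by
  intro x y hxy
  have h2 : x.2 = y.2 := by
    have h := cs.one_mem_rootHalfSpace_iff x
    rw [hxy, one_mem_rootHalfSpace_iff] at h
    revert h
    rcases Int.units_eq_one_or x.2 with a | a <;> rcases Int.units_eq_one_or y.2 with b | b <;>
      rw [a, b] <;> decide
  obtain ⟨g, i, rfl⟩ := cs.exists_rootAction_simpleRoot x
  obtain ⟨z, rfl⟩ := (cs.rootAction g).surjective y
  rw [← smul_rootHalfSpace, ← smul_rootHalfSpace, smul_left_cancel_iff] at hxy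
  congr 1
  have h1 := cs.one_mem_rootHalfSpace_iff (cs.simpleRoot i)
  rw [hxy, one_mem_rootHalfSpace_iff] at h1
  have hz : z.2 = 1 := h1.2 rfl
  have h3 := cs.mem_rootHalfSpace_iff (cs.simpleRoot i) (cs.simple i)
  have h4 : cs.rootAction (cs.simple i) (cs.simpleRoot i) = ((cs.simpleRoot i).1, -1) :=
    cs.rootAction_self ⟨cs.simple i, cs.isReflection_simple i⟩ 1
  rw [inv_simple, h4, hxy, mem_rootHalfSpace_iff, inv_simple, rootAction_simple] at h3
  by_cases hzi : (z.1 : W) = cs.simple i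
  · exact (Prod.ext (Subtype.ext hzi) hz).symm
  · simp [rootStep, hzi, hz] at h3

/-- The bijection from the abstract root system to the set of half-spaces. -/
noncomputable def rootEquivHalfSpaces :
    ({t : W // cs.IsReflection t} × ℤˣ) ≃ halfSpaces (Set.range cs.simple) :=
  Equiv.ofBijective (fun x => ⟨cs.rootHalfSpace x, cs.rootHalfSpace_mem_halfSpaces x⟩) (by
    refine ⟨fun x y h => cs.rootHalfSpace_injective (congrArg Subtype.val h), ?_⟩
    rintro ⟨_, g, _, ⟨i, rfl⟩, rfl⟩
    refine ⟨cs.rootAction g (cs.simpleRoot i), Subtype.ext ?_⟩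
    exact (cs.smul_rootHalfSpace g (cs.simpleRoot i)).symm.trans
      (congrArg (g • ·) (cs.rootHalfSpace_simpleRoot i)))

theorem xor_mem_rootHalfSpace_iff (g : W) (x : {t : W // cs.IsReflection t} × ℤˣ) :
    Xor (1 ∈ cs.rootHalfSpace x) (g ∈ cs.rootHalfSpace x) ↔
      (x.1 : W) ∈ cs.leftInversions g := by
  rw [one_mem_rootHalfSpace_iff, mem_rootHalfSpace_iff, leftInversions, Set.mem_ofPred_eq,
    isLeftInversion_iff_rootAction]
  generalize cs.rootAction g⁻¹ x = y
  rcases Int.units_eq_one_or x.2 with e | e <;> rcases Int.units_eq_one_or y.2 with e' | e' <;>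
    rw [e, e'] <;> decide

theorem mem_setProtorootoidOf_N_iff (g : W) (A : halfSpaces (Set.range cs.simple)) :
    A ∈ (setProtorootoidOf (Set.range cs.simple)).N g ↔
      ((cs.rootEquivHalfSpaces.symm A).1 : W) ∈ cs.leftInversions g := by
  obtain ⟨x, rfl⟩ := cs.rootEquivHalfSpaces.surjective A
  rw [Equiv.symm_apply_apply, ← xor_mem_rootHalfSpace_iff]
  have h1 : cs.rootEquivHalfSpaces x ∈
      g • {A : halfSpaces (Set.range cs.simple) | (1 : W) ∈ (A : Set W)} ↔
      g ∈ cs.rootHalfSpace x := by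
    rw [Set.mem_smul_set_iff_inv_smul_mem]
    change (1 : W) ∈ g⁻¹ • cs.rootHalfSpace x ↔ _
    rw [Set.mem_smul_set_iff_inv_smul_mem, inv_inv, smul_eq_mul, mul_one]
  rw [← h1]
  exact Set.mem_symmDiff

/-- Each inversion of g accounts for two opposite half-spaces, so N(g) corresponds to Φ_g × {±}. -/
theorem rank_setProtorootoidOf (g : W) :
    (setProtorootoidOf (Set.range cs.simple)).toProtorootoid.rank g = 2 * cs.length g := by
  rw [SetProtorootoid.rank_eq_encard]
  have h : (fun x => ((cs.rootEquivHalfSpaces.symm x).1.1, (cs.rootEquivHalfSpaces.symm x).2)) ''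
      (setProtorootoidOf (Set.range cs.simple)).N g =
      cs.leftInversions g ×ˢ (Set.univ : Set ℤˣ) := by
    ext ⟨t, e⟩
    rw [Set.mem_prod]
    constructor
    · rintro ⟨A, hA, h⟩
      rw [← h]
      exact ⟨(cs.mem_setProtorootoidOf_N_iff g A).1 hA, trivial⟩
    · rintro ⟨ht, -⟩
      refine ⟨cs.rootEquivHalfSpaces (⟨t, ht.1⟩, e), ?_, ?_⟩
      · refine (cs.mem_setProtorootoidOf_N_iff g _).2 ?_
        rw [Equiv.symm_apply_apply]
        exact ht
      · simp only [Equiv.symm_apply_apply]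
  have hinj : Function.Injective fun x : halfSpaces (Set.range cs.simple) =>
      ((cs.rootEquivHalfSpaces.symm x).1.1, (cs.rootEquivHalfSpaces.symm x).2) := by
    intro A A' hAA
    exact cs.rootEquivHalfSpaces.symm.injective
      (Prod.ext (Subtype.ext (Prod.ext_iff.1 hAA).1) (Prod.ext_iff.1 hAA).2)
  have h2 := hinj.encard_image ((setProtorootoidOf (Set.range cs.simple)).N g)
  have h3 : (Set.univ : Set ℤˣ).encard = 2 := by
    rw [Set.encard_univ, ENat.card_eq_coe_fintype_card]
    rfl
  refine h2.symm.trans ?_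
  rw [h, Set.encard_prod, encard_leftInversions, h3, mul_comm]

theorem isC2System : IsC2System (Set.range cs.simple) where
  toIsC0System := cs.isEvenC0System.toIsC0System
  cocycleFinite g := by
    rw [rank_setProtorootoidOf]
    exact ENat.natCast_ne_top (2 * cs.length g)
  rank_eq g := by rw [rank_setProtorootoidOf, wordLength_range_simple]
  isRootoid := cs.isRootoid_of_pullback (setProtorootoidOf (Set.range cs.simple))
    (fun A => (cs.rootEquivHalfSpaces.symm A).1)
    (fun t => ⟨cs.rootEquivHalfSpaces (t, 1), congrArg Prod.fst (Equiv.symm_apply_apply _ _)⟩)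
    cs.mem_setProtorootoidOf_N_iff

/-! ### The signed isomorphism and the protorootoid of walls -/

theorem rootEquivHalfSpaces_neg (x : {t : W // cs.IsReflection t} × ℤˣ) :
    cs.rootEquivHalfSpaces (x.1, -x.2) =
      cs.isEvenC0System.signedHalfSpaces.neg (cs.rootEquivHalfSpaces x) :=
  Subtype.ext (cs.rootHalfSpace_neg x)

theorem isIso_rootEquivHalfSpaces :
    SignedGSet.IsIso (Φ := cs.abstractRootSystem) (Φ' := cs.isEvenC0System.signedHalfSpaces)
      cs.rootEquivHalfSpaces where
  map_smul g x := Subtype.ext (cs.smul_rootHalfSpace g x).symm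
  map_neg x := cs.rootEquivHalfSpaces_neg x
  bijective := cs.rootEquivHalfSpaces.bijective
  mem_pos_iff x := cs.one_mem_rootHalfSpace_iff x

/-- The reflection of a pair of opposite half-spaces. -/
noncomputable def reflectionOfWall
    (q : Quotient cs.isEvenC0System.signedHalfSpaces.signSetoid) : {t : W // cs.IsReflection t} :=
  Quotient.lift (fun A => (cs.rootEquivHalfSpaces.symm A).1) (by
    intro A A' h
    rcases h with rfl | rfl
    · rfl
    · obtain ⟨x, rfl⟩ := cs.rootEquivHalfSpaces.surjective A'
      rw [← rootEquivHalfSpaces_neg, Equiv.symm_apply_apply, Equiv.symm_apply_apply]) q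

theorem reflectionOfWall_mk (x : {t : W // cs.IsReflection t} × ℤˣ) :
    cs.reflectionOfWall (Quotient.mk _ (cs.rootEquivHalfSpaces x)) = x.1 :=
  congrArg Prod.fst (Equiv.symm_apply_apply _ _)

/-- On T × {±} the sign orbits are the fibres of the projection to T. -/
theorem reflectionOfWall_bijective : Function.Bijective cs.reflectionOfWall := by
  constructor
  · intro q q' h
    obtain ⟨A, rfl⟩ := Quotient.exists_rep q
    obtain ⟨A', rfl⟩ := Quotient.exists_rep q'
    obtain ⟨x, rfl⟩ := cs.rootEquivHalfSpaces.surjective A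
    obtain ⟨y, rfl⟩ := cs.rootEquivHalfSpaces.surjective A'
    rw [reflectionOfWall_mk, reflectionOfWall_mk] at h
    apply Quotient.sound
    by_cases he : x.2 = y.2
    · exact Or.inl (congrArg _ (Prod.ext h he))
    · refine Or.inr ?_
      rw [← rootEquivHalfSpaces_neg]
      refine congrArg _ (Prod.ext h ?_)
      exact (Int.units_ne_iff_eq_neg.1 he)
  · exact fun t => ⟨_, cs.reflectionOfWall_mk (t, 1)⟩

theorem mem_signedHalfSpaces_N_iff (g : W)
    (q : cs.isEvenC0System.signedHalfSpaces.toSetProtorootoid.Ψ) :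
    q ∈ cs.isEvenC0System.signedHalfSpaces.toSetProtorootoid.N g ↔
      (cs.reflectionOfWall q : W) ∈ cs.leftInversions g := by
  obtain ⟨A, rfl⟩ := Quotient.exists_rep q
  obtain ⟨x, rfl⟩ := cs.rootEquivHalfSpaces.surjective A
  rw [reflectionOfWall_mk, ← xor_mem_rootHalfSpace_iff]
  refine (SignedGSet.mk_mem_iff _ g _).trans ?_
  have h : (g⁻¹ • (show cs.isEvenC0System.signedHalfSpaces.carrier from cs.rootEquivHalfSpaces x) ∈
      cs.isEvenC0System.signedHalfSpaces.pos) ↔ g ∈ cs.rootHalfSpace x := by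
    change (1 : W) ∈ g⁻¹ • cs.rootHalfSpace x ↔ _
    rw [Set.mem_smul_set_iff_inv_smul_mem, inv_inv, smul_eq_mul, mul_one]
  rw [← h]
  rfl

theorem rank_signedHalfSpaces (g : W) :
    cs.isEvenC0System.signedHalfSpaces.toSetProtorootoid.toProtorootoid.rank g =
      cs.length g := by
  rw [SetProtorootoid.rank_eq_encard, ← encard_leftInversions]
  have hinj := Subtype.val_injective.comp cs.reflectionOfWall_bijective.1
  refine (hinj.encard_image _).symm.trans (congrArg _ ?_)
  ext t
  constructor
  · rintro ⟨q, hq, rfl⟩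
    exact (cs.mem_signedHalfSpaces_N_iff g q).1 hq
  · intro ht
    obtain ⟨q, hq⟩ := cs.reflectionOfWall_bijective.2 ⟨t, ht.1⟩
    refine ⟨q, (cs.mem_signedHalfSpaces_N_iff g q).2 ?_, congrArg Subtype.val hq⟩
    rw [hq]
    exact ht

theorem isRootoid_signedHalfSpaces :
    cs.isEvenC0System.signedHalfSpaces.toSetProtorootoid.toProtorootoid.IsRootoid :=
  cs.isRootoid_of_pullback _ cs.reflectionOfWall cs.reflectionOfWall_bijective.2
    cs.mem_signedHalfSpaces_N_iff

theorem simples_signedHalfSpaces :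
    cs.isEvenC0System.signedHalfSpaces.toSetProtorootoid.toProtorootoid.simples =
      Set.range cs.simple := by
  ext g
  rw [Protorootoid.simples, Set.mem_ofPred_eq, rank_signedHalfSpaces, Nat.cast_eq_one,
    length_eq_one_iff]
  exact exists_congr fun i => eq_comm

theorem isPrincipal_signedHalfSpaces :
    cs.isEvenC0System.signedHalfSpaces.toSetProtorootoid.toProtorootoid.IsPrincipal where
  faithful := cs.isRootoid_signedHalfSpaces.faithful
  cocycleFinite g := by
    rw [rank_signedHalfSpaces]
    exact ENat.natCast_ne_top _
  closure_simples := by rw [simples_signedHalfSpaces, subgroup_closure_range_simple]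
  rank_eq g := by rw [rank_signedHalfSpaces, simples_signedHalfSpaces, wordLength_range_simple]

/-- Every root is a W-translate of some (s, +), so equivariance determines the map. -/
theorem eq_rootEquivHalfSpaces
    {f : cs.abstractRootSystem.carrier → cs.isEvenC0System.signedHalfSpaces.carrier}
    (hf : SignedGSet.IsHom f)
    (hs : ∀ i, (f (cs.simpleRoot i)).1 = posHalf (Set.range cs.simple) (cs.simple i)) :
    f = cs.rootEquivHalfSpaces := by
  funext x
  obtain ⟨g, i, rfl⟩ := cs.exists_rootAction_simpleRoot x
  refine (hf.map_smul g (cs.simpleRoot i)).trans (Eq.trans (congrArg (g • ·) ?_)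
    (cs.isIso_rootEquivHalfSpaces.map_smul g (cs.simpleRoot i)).symm)
  exact Subtype.ext ((hs i).trans (cs.rootHalfSpace_simpleRoot i).symm)

end CoxeterSystem

theorem proposition8p5 {B : Type*} {M : CoxeterMatrix B} {W : Type*} [Group W]
    (cs : CoxeterSystem M W) :
    ∃ hS : IsEvenC0System (Set.range cs.simple),
      IsC2System (Set.range cs.simple) ∧
      (∃ f : cs.abstractRootSystem.carrier → hS.signedHalfSpaces.carrier,
        SignedGSet.IsIso f ∧
        (∀ i : B, (f (cs.simpleRoot i)).1 = posHalf (Set.range cs.simple) (cs.simple i)) ∧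
        (∀ x, (f x).1 = cs.rootHalfSpace x) ∧
        ∀ f' : cs.abstractRootSystem.carrier → hS.signedHalfSpaces.carrier,
          SignedGSet.IsHom f' →
          (∀ i : B, (f' (cs.simpleRoot i)).1 = posHalf (Set.range cs.simple) (cs.simple i)) →
          f' = f) ∧
      hS.signedHalfSpaces.toSetProtorootoid.toProtorootoid.IsRootoid ∧
      hS.signedHalfSpaces.toSetProtorootoid.toProtorootoid.IsPrincipal ∧
      hS.signedHalfSpaces.toSetProtorootoid.toProtorootoid.simples = Set.range cs.simple := by
  exact ⟨cs.isEvenC0System, cs.isC2System, ⟨cs.rootEquivHalfSpaces, cs.isIso_rootEquivHalfSpaces,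
    cs.rootHalfSpace_simpleRoot, fun _ => rfl, fun _ => cs.eq_rootEquivHalfSpaces⟩,
    cs.isRootoid_signedHalfSpaces, cs.isPrincipal_signedHalfSpaces, cs.simples_signedHalfSpaces⟩
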